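/- Let $k/k_0$ be a quadratic extension of number fields, let $L/k$ be a finite Galois extension with Galois group $G$, and assume $L\subseteq\mathbb{C}$ (so $k_0\subseteq k\subseteq L\subseteq\mathbb{C}$). Assume that the nontrivial $k_0$-automorphism of $k$ is complex conjugation and that complex conjugation induces an automorphism $\alpha$ of $L$. Let $\xi\colon G\times G\to L^\times$ be a $2$-cocycle with $\alpha(\xi_{\sigma,\rho})\,\xi_{\sigma,\rho}=1$ for all $\sigma,\rho\in G$, and let $B=(\xi,L/k,G)$ be the crossed product algebra, i.e. $B=\bigoplus_{\sigma\in G}L u_\sigma$ with $u_\sigma a=\sigma(a)u_\sigma$ for $a\in L$ and $u_\sigma u_\rho=\xi_{\sigma,\rho}u_{\sigma\rho}$. Assume that $B$ is a division algebra. A unitary involution $\tau$ on $B$ (a ring anti-automorphism of $B$ with $\tau^2=\mathrm{id}$ whose restriction to $k$ is complex conjugation) is called positive if $\mathrm{Trd}_B(\tau(x)x)>0$ for all $x\in B\setminus\{0\}$, where $\mathrm{Trd}_B\colon B\to k$ is the reduced trace; here $\mathrm{Trd}_B(\tau(x)x)\in k_0\subseteq\mathbb{R}$. If $B$ carries a positive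 unitary involution $\tau$ with $\tau|_L=\alpha$, then $\alpha\circ\sigma=\sigma\circ\alpha$ for every $\sigma\in G$. -/

import Mathlib

open groupCohomology
open scoped TensorProduct

/-- The crossed product `(ξ, L/F, Gal(L/F))` attached to a multiplicative `2`-cocycle `ξ` of
`Gal(L/F)` with values in `Lˣ`: the left `L`-vector space with basis `(u_σ)` indexed by the Galois
group.  An element `∑ σ, x_σ u_σ` is represented by its coefficient function `σ ↦ x_σ`.
The multiplication is determined by `u_σ a = σ(a) u_σ` and `u_σ u_ρ = ξ(σ, ρ) u_{σρ}`;
the cocycle is not assumed to be normalized. -/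
def CrossedProduct {F L : Type*} [Field F] [Field L] [Algebra F L]
    {ξ : (L ≃ₐ[F] L) × (L ≃ₐ[F] L) → Lˣ} (_hξ : IsMulCocycle₂ ξ) : Type _ :=
  (L ≃ₐ[F] L) → L

namespace CrossedProduct

section

variable {F L : Type*} [Field F] [Field L] [Algebra F L]
  {ξ : (L ≃ₐ[F] L) × (L ≃ₐ[F] L) → Lˣ} (hξ : IsMulCocycle₂ ξ)

instance : AddCommGroup (CrossedProduct hξ) :=
  inferInstanceAs (AddCommGroup ((L ≃ₐ[F] L) → L))

instance : Module F (CrossedProduct hξ) :=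
  inferInstanceAs (Module F ((L ≃ₐ[F] L) → L))

/-- The coefficient of `u_σ`. -/
def coeff (x : CrossedProduct hξ) (σ : L ≃ₐ[F] L) : L := x σ

/-- The element `a u_σ`. -/
noncomputable def single (σ : L ≃ₐ[F] L) (a : L) : CrossedProduct hξ :=
  open Classical in (Pi.single σ a : (L ≃ₐ[F] L) → L)

variable {hξ}

@[ext] theorem ext {x y : CrossedProduct hξ} (h : ∀ σ, coeff hξ x σ = coeff hξ y σ) : x = y :=
  funext h

@[simp] theorem coeff_add (x y : CrossedProduct hξ) (σ : L ≃ₐ[F] L) :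
    coeff hξ (x + y) σ = coeff hξ x σ + coeff hξ y σ := rfl

@[simp] theorem coeff_zero (σ : L ≃ₐ[F] L) : coeff hξ 0 σ = 0 := rfl

@[simp] theorem coeff_smul (c : F) (x : CrossedProduct hξ) (σ : L ≃ₐ[F] L) :
    coeff hξ (c • x) σ = c • coeff hξ x σ := rfl

open Classical in
theorem coeff_single (σ ρ : L ≃ₐ[F] L) (a : L) :
    coeff hξ (single hξ σ a) ρ = if ρ = σ then a else 0 := by
  simp [coeff, single, Pi.single_apply]

/-- The cocycle identity, read in `L`. -/
theorem cocycle (hξ : IsMulCocycle₂ ξ) (σ ρ π : L ≃ₐ[F] L) :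
    (ξ (σ * ρ, π) : L) * ξ (σ, ρ) = σ (ξ (ρ, π)) * ξ (σ, ρ * π) := by
  simpa using congrArg Units.val (hξ σ ρ π)

/-- The unit is `ξ(1, 1)⁻¹ u_1`. -/
noncomputable instance : One (CrossedProduct hξ) where
  one := single hξ 1 ((ξ (1, 1))⁻¹ : Lˣ)

theorem one_def : (1 : CrossedProduct hξ) = single hξ 1 ((ξ (1, 1))⁻¹ : Lˣ) := rfl

variable [FiniteDimensional F L]

/-- `(∑ σ, x_σ u_σ) (∑ ρ, y_ρ u_ρ) = ∑ σ, ∑ ρ, x_σ σ(y_ρ) ξ(σ, ρ) u_{σρ}`. -/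
noncomputable instance : Mul (CrossedProduct hξ) where
  mul x y := fun π => ∑ σ : L ≃ₐ[F] L,
    coeff hξ x σ * σ (coeff hξ y (σ⁻¹ * π)) * ξ (σ, σ⁻¹ * π)

theorem coeff_mul (x y : CrossedProduct hξ) (π : L ≃ₐ[F] L) :
    coeff hξ (x * y) π = ∑ σ : L ≃ₐ[F] L,
      coeff hξ x σ * σ (coeff hξ y (σ⁻¹ * π)) * ξ (σ, σ⁻¹ * π) := rfl

theorem single_mul_single (σ ρ : L ≃ₐ[F] L) (a b : L) :
    single hξ σ a * single hξ ρ b = single hξ (σ * ρ) (a * σ b * ξ (σ, ρ)) := by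
  classical
  ext π
  rw [coeff_mul, Finset.sum_eq_single σ]
  · simp only [coeff_single, if_true, inv_mul_eq_iff_eq_mul]
    split_ifs with h
    · subst h; simp
    · simp
  · intro τ _ hτ
    simp [coeff_single, hτ]
  · simp

noncomputable instance : Ring (CrossedProduct hξ) where
  __ := (inferInstance : AddCommGroup (CrossedProduct hξ))
  __ := (inferInstance : Mul (CrossedProduct hξ))
  __ := (inferInstance : One (CrossedProduct hξ))
  left_distrib x y z := by
    ext π
    simp only [coeff_mul, coeff_add, map_add, mul_add, add_mul, Finset.sum_add_distrib]
  right_distrib x y z := by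
    ext π
    simp only [coeff_mul, coeff_add, add_mul, Finset.sum_add_distrib]
  zero_mul x := by ext π; simp [coeff_mul]
  mul_zero x := by ext π; simp [coeff_mul]
  mul_assoc x y z := by
    ext τ
    simp only [coeff_mul, map_sum, Finset.sum_mul, Finset.mul_sum, map_mul]
    rw [Finset.sum_comm]
    refine Finset.sum_congr rfl fun σ _ => ?_
    refine Fintype.sum_equiv (Equiv.mulLeft σ⁻¹) _ _ fun ρ => ?_
    have h := cocycle hξ σ (σ⁻¹ * ρ) (ρ⁻¹ * τ)
    have e1 : σ * (σ⁻¹ * ρ) = ρ := by group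
    have e2 : σ⁻¹ * ρ * (ρ⁻¹ * τ) = σ⁻¹ * τ := by group
    have e3 : (σ⁻¹ * ρ)⁻¹ * (σ⁻¹ * τ) = ρ⁻¹ * τ := by group
    rw [e1, e2] at h
    simp only [Equiv.coe_mulLeft, e3, ← AlgEquiv.mul_apply, e1]
    linear_combination
      (coeff hξ x σ * σ (coeff hξ y (σ⁻¹ * ρ)) * ρ (coeff hξ z (ρ⁻¹ * τ))) * h
  one_mul x := by
    classical
    ext π
    rw [coeff_mul, Finset.sum_eq_single 1]
    · simp only [one_def, coeff_single, if_true, inv_one, one_mul, AlgEquiv.one_apply]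
      rw [map_one_fst_of_isMulCocycle₂ hξ π, mul_right_comm]
      simp
    · intro σ _ hσ
      simp [one_def, coeff_single, hσ]
    · simp
  mul_one x := by
    classical
    ext π
    rw [coeff_mul, Finset.sum_eq_single π]
    · simp only [one_def, coeff_single, if_true, inv_mul_cancel]
      rw [map_one_snd_of_isMulCocycle₂ hξ π, mul_assoc]
      simp
    · intro σ _ hσ
      have : σ⁻¹ * π ≠ 1 := fun h => hσ (inv_mul_eq_one.1 h)
      simp [one_def, coeff_single, this]
    · simp

noncomputable instance : Algebra F (CrossedProduct hξ) :=
  Algebra.ofModule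
    (fun c x y => by
      ext π
      simp only [coeff_mul, coeff_smul, Finset.smul_sum, smul_mul_assoc])
    (fun c x y => by
      ext π
      simp only [coeff_mul, coeff_smul, Finset.smul_sum, map_smul, smul_mul_assoc,
        mul_smul_comm])

variable (hξ) in
/-- The embedding of `L` as a subfield, `a ↦ a • 1 = a ξ(1, 1)⁻¹ u_1`. -/
noncomputable def ofField : L →ₐ[F] CrossedProduct hξ :=
  AlgHom.ofLinearMap
    { toFun := fun a => single hξ 1 (a * ((ξ (1, 1))⁻¹ : Lˣ))
      map_add' := fun a b => by
        classical
        ext π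
        simp only [coeff_add, coeff_single]
        split_ifs <;> simp [add_mul]
      map_smul' := fun c a => by
        classical
        ext π
        simp only [coeff_smul, coeff_single, RingHom.id_apply]
        split_ifs <;> simp }
    (by simp [one_def])
    (fun a b => by
      simp only [LinearMap.coe_mk, AddHom.coe_mk, single_mul_single, AlgEquiv.one_apply, one_mul]
      congr 1
      have : ((ξ (1, 1))⁻¹ : Lˣ) * (ξ (1, 1) : L) = 1 := Units.inv_mul _
      linear_combination (-(a * b * ((ξ (1, 1))⁻¹ : Lˣ))) * this)

/-- The defining relation `u_σ a = σ(a) u_σ`. -/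
theorem single_mul_ofField (σ : L ≃ₐ[F] L) (a : L) :
    single hξ σ 1 * ofField hξ a = ofField hξ (σ a) * single hξ σ 1 := by
  simp only [ofField, AlgHom.ofLinearMap_apply, LinearMap.coe_mk, AddHom.coe_mk,
    single_mul_single, mul_one, one_mul]
  congr 1
  rw [map_one_fst_of_isMulCocycle₂ hξ σ, map_one_snd_of_isMulCocycle₂ hξ σ]
  have h1 : ((ξ (1, 1))⁻¹ : Lˣ) * (ξ (1, 1) : L) = 1 := Units.inv_mul _
  have h2 := congrArg σ h1
  simp only [map_mul, map_one] at h2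
  simp only [map_mul, AlgEquiv.smul_units_def, Units.coe_map, MonoidHom.coe_coe, map_one, mul_one]
  linear_combination (σ a) * h2 - (σ a) * h1

/-- The defining relation `u_σ u_ρ = ξ(σ, ρ) u_{σρ}`. -/
theorem single_mul_single_one (σ ρ : L ≃ₐ[F] L) :
    single hξ σ 1 * single hξ ρ 1 = ofField hξ (ξ (σ, ρ)) * single hξ (σ * ρ) 1 := by
  simp only [ofField, AlgHom.ofLinearMap_apply, LinearMap.coe_mk, AddHom.coe_mk,
    single_mul_single, mul_one, one_mul, map_one]
  congr 1
  rw [map_one_fst_of_isMulCocycle₂ hξ (σ * ρ)]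
  simp

end

end CrossedProduct

/-- `T` is a reduced trace of the `F`-algebra `B`: for a splitting
`φ : Ω ⊗ B ≃ Mₙ(Ω)` over the algebraic closure `Ω` of `F`, one has `T b = tr (φ (1 ⊗ b))`.
Every central simple algebra has a unique such `T`. -/
def IsReducedTrace (F B : Type*) [Field F] [Ring B] [Algebra F B] (T : B →ₗ[F] F) : Prop :=
  ∃ (n : ℕ) (φ : AlgebraicClosure F ⊗[F] B ≃ₐ[AlgebraicClosure F]
      Matrix (Fin n) (Fin n) (AlgebraicClosure F)),
    ∀ b : B, algebraMap F (AlgebraicClosure F) (T b) = (φ (1 ⊗ₜ[F] b)).trace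

/-- The reduced trace does not depend on the splitting. -/
theorem IsReducedTrace.eq {F B : Type*} [Field F] [Ring B] [Algebra F B] {T T' : B →ₗ[F] F}
    (h : IsReducedTrace F B T) (h' : IsReducedTrace F B T') : T = T' := by
  obtain ⟨n, φ, hφ⟩ := h
  obtain ⟨m, ψ, hψ⟩ := h'
  ext b
  apply (algebraMap F (AlgebraicClosure F)).injective
  rw [hφ, hψ, ← Matrix.trace_map (φ.symm.trans ψ) (φ (1 ⊗ₜ[F] b))]
  simp

open Classical in
/-- The reduced trace `Trd_B : B → F` of a central simple `F`-algebra `B`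
(zero if `B` has no reduced trace). -/
noncomputable def reducedTrace (F B : Type*) [Field F] [Ring B] [Algebra F B] : B →ₗ[F] F :=
  if h : ∃ T : B →ₗ[F] F, IsReducedTrace F B T then h.choose else 0

theorem IsReducedTrace.reducedTrace_eq {F B : Type*} [Field F] [Ring B] [Algebra F B]
    {T : B →ₗ[F] F} (h : IsReducedTrace F B T) : reducedTrace F B = T := by
  have hex : ∃ T : B →ₗ[F] F, IsReducedTrace F B T := ⟨T, h⟩
  rw [reducedTrace, dif_pos hex]
  exact hex.choose_spec.eq h

/-- For an automorphism `c` of order two of `F` with fixed field `F₀`: `τ` is a unitary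
`F/F₀`-involution on the `F`-algebra `B`, i.e. a ring anti-automorphism of `B` with `τ² = id`
that restricts to `c` on `F`. -/
structure IsUnitaryInvolution {F B : Type*} [Field F] [Ring B] [Algebra F B]
    (c : F → F) (τ : B → B) : Prop where
  map_add : ∀ x y, τ (x + y) = τ x + τ y
  map_mul : ∀ x y, τ (x * y) = τ y * τ x
  involutive : ∀ x, τ (τ x) = x
  map_algebraMap : ∀ a : F, τ (algebraMap F B a) = algebraMap F B (c a)

/-- For a field `F` embedded in `ℂ` by `j` and a unitary involution `τ` on the central simple
`F`-algebra `B` inducing complex conjugation on `F`: the involution trace form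
`x ↦ Trd_B (τ x * x)` is positive definite for the ordering of the fixed field of complex
conjugation in `F` that is induced from `ℝ`.  The values of this form are fixed by complex
conjugation, hence real, so their sign is that of their real part. -/
def IsPositiveInvolution {F B : Type*} [Field F] [Ring B] [Algebra F B] (j : F →+* ℂ)
    (τ : B → B) : Prop :=
  ∀ x : B, x ≠ 0 → 0 < (j (reducedTrace F B (τ x * x))).re

/-!
Approximate the elements of `L` simultaneously at finitely many archimedean places of `L`.  If
`α` moved the place of `ι ∘ ρ` for some `ρ` in the Galois group, an `x : L` close to `1` at this
place, close to `-1` at its image under `α`, and close to `0` at the remaining places of the form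
`ι ∘ σ` and `ι ∘ σ ∘ α` would make `Tr_{L/k} (α x * x)` negative.  But this trace is the reduced
trace of `τ x * x` for `x` in the maximal subfield `L`, so positivity of `τ` forces `α` to fix all
these places, and two embeddings into `ℂ` with the same place agree up to conjugation.
-/

section WeakApproximation

open Filter Topology NumberField

theorem exists_seq_tendsto_embeddings {K I : Type*} [Field K] [Finite I] (φ : I → K →+* ℂ)
    (a : InfinitePlace K → K) :
    ∃ x : ℕ → K, ∀ i, Tendsto (fun n => φ i (x n)) atTop (𝓝 (φ i (a (.mk (φ i))))) := by
  let v : Set.range (fun i => InfinitePlace.mk (φ i)) → AbsoluteValue K ℝ := fun w => w.1.1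
  have hdense : DenseRange (algebraMap K ((w : _) → WithAbs (v w))) :=
    AbsoluteValue.denseRange_algebraMap_pi (fun w => w.1.isNontrivial) fun w w' hw =>
      InfinitePlace.eq_iff_isEquiv.not.1 (Subtype.coe_injective.ne hw)
  obtain ⟨y, hy, hlim⟩ :=
    mem_closure_iff_seq_limit.1 (hdense fun w => WithAbs.toAbs _ (a w.1))
  choose x hx using hy
  refine ⟨x, fun i => tendsto_iff_norm_sub_tendsto_zero.2 ?_⟩
  have hnorm := tendsto_iff_norm_sub_tendsto_zero.1 (tendsto_pi_nhds.1 hlim ⟨_, i, rfl⟩)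
  refine hnorm.congr fun n => ?_
  rw [← map_sub, ← hx n]
  rfl

theorem exists_map_eq_neg_of_involutive {X : Type*} {f : X → X} (hf : Function.Involutive f)
    {v : X} (hv : f v ≠ v) : ∃ a : X → ℤ, (∀ w, a (f w) = -a w) ∧ a v = 1 := by
  classical
  refine ⟨Pi.single v 1 - Pi.single (f v) 1, fun w => ?_, by simp [hv.symm]⟩
  have hw : f w = v ↔ w = f v := hf.eq_iff
  simp [Pi.single_apply, hw, hf.injective.eq_iff]

theorem comap_mk_eq_of_sum_mul_nonneg {K I : Type*} [Field K] [Fintype I] (φ : I → K →+* ℂ)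
    (α : K →+* K) (hα : Function.Involutive α) (hpos : ∀ x, 0 ≤ (∑ i, φ i (α x) * φ i x).re)
    (i : I) : (InfinitePlace.mk (φ i)).comap α = .mk (φ i) := by
  by_contra hne
  have hcomap : Function.Involutive fun w : InfinitePlace K => w.comap α := fun w => by
    ext x
    simp [hα x]
  obtain ⟨a, ha, hai⟩ := exists_map_eq_neg_of_involutive hcomap hne
  obtain ⟨x, hx⟩ := exists_seq_tendsto_embeddings (Sum.elim φ fun j => (φ j).comp α)
    fun w => (a w : K)
  have hφ (j : I) : Tendsto (fun n => φ j (x n)) atTop (𝓝 (a (.mk (φ j)) : ℂ)) := by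
    simpa using hx (.inl j)
  have hφα (j : I) : Tendsto (fun n => φ j (α (x n))) atTop (𝓝 (-a (.mk (φ j)) : ℂ)) := by
    simpa [← InfinitePlace.comap_mk, ha] using hx (.inr j)
  have hlim : Tendsto (fun n => ∑ j, φ j (α (x n)) * φ j (x n)) atTop
      (𝓝 (∑ j, -a (.mk (φ j)) * a (.mk (φ j)) : ℂ)) :=
    tendsto_finsetSum _ fun j _ => (hφα j).mul (hφ j)
  have hnonneg : 0 ≤ (∑ j, -a (.mk (φ j)) * a (.mk (φ j)) : ℂ).re :=
    ge_of_tendsto' ((Complex.continuous_re.tendsto _).comp hlim) fun n => hpos (x n)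
  have hle : a (.mk (φ i)) * a (.mk (φ i)) ≤ ∑ j, a (.mk (φ j)) * a (.mk (φ j)) :=
    Finset.single_le_sum (f := fun j => a (.mk (φ j)) * a (.mk (φ j)))
      (fun j _ => mul_self_nonneg _) (Finset.mem_univ i)
  have hnonpos : ∑ j, a (.mk (φ j)) * a (.mk (φ j)) ≤ 0 := by
    simpa [← Int.cast_mul, ← Int.cast_sum] using hnonneg
  simp only [hai] at hle
  linarith

theorem map_comm_of_trace_mul_self_nonneg {F L : Type*} [Field F] [Field L] [Algebra F L]
    [FiniteDimensional F L] [IsGalois F L] (ι : L →+* ℂ) (α : L →+* L)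
    (hα : ∀ x, ι (α x) = starRingEnd ℂ (ι x))
    (hpos : ∀ x, 0 ≤ (ι (algebraMap F L (Algebra.trace F L (α x * x)))).re)
    (σ : L ≃ₐ[F] L) (x : L) : α (σ x) = σ (α x) := by
  have hαα : Function.Involutive α := fun y => ι.injective (by simp [hα])
  have hplace := comap_mk_eq_of_sum_mul_nonneg (fun ρ : L ≃ₐ[F] L => ι.comp (ρ : L →+* L)) α hαα
    (fun y => by simpa [trace_eq_sum_automorphisms] using hpos y) σ
  rw [InfinitePlace.comap_mk, InfinitePlace.mk_eq_iff] at hplace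
  rcases hplace with heq | hconj
  · have hα_id (y : L) : α y = y := σ.injective (ι.injective (DFunLike.congr_fun heq y))
    rw [hα_id, hα_id]
  · apply ι.injective
    calc ι (α (σ x)) = starRingEnd ℂ (ι (σ x)) := hα _
      _ = starRingEnd ℂ (starRingEnd ℂ (ι (σ (α x)))) :=
        congrArg _ (DFunLike.congr_fun hconj x).symm
      _ = ι (σ (α x)) := Complex.conj_conj _

end WeakApproximation

theorem span_range_conjugates_eq_top {F L K : Type*} [Field F] [Field L] [Algebra F L] [Field K]
    [FiniteDimensional F L] (j : L →+* K) :
    Submodule.span K (Set.range fun (x : L) (σ : L ≃ₐ[F] L) => j (σ x)) = ⊤ := by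
  refine span_flip_eq_top_iff_linearIndependent.2 ((linearIndependent_monoidHom L K).comp
    (fun σ : L ≃ₐ[F] L => ((j.comp (σ : L →+* L) : L →+* K) : L →* K)) fun σ ρ h => ?_)
  ext x
  exact j.injective (DFunLike.congr_fun h x)

namespace CrossedProduct

variable {F L : Type*} [Field F] [Field L] [Algebra F L] [FiniteDimensional F L]
  {ξ : (L ≃ₐ[F] L) × (L ≃ₐ[F] L) → Lˣ}

instance (hξ : IsMulCocycle₂ ξ) : Nontrivial (CrossedProduct hξ) :=
  inferInstanceAs (Nontrivial ((L ≃ₐ[F] L) → L))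

instance (hξ : IsMulCocycle₂ ξ) : FiniteDimensional F (CrossedProduct hξ) :=
  inferInstanceAs (FiniteDimensional F ((L ≃ₐ[F] L) → L))

theorem finrank_eq_card_mul_card [IsGalois F L] (hξ : IsMulCocycle₂ ξ) :
    Module.finrank F (CrossedProduct hξ) =
      Fintype.card (L ≃ₐ[F] L) * Fintype.card (L ≃ₐ[F] L) := by
  calc Module.finrank F ((L ≃ₐ[F] L) → L)
      = Fintype.card (L ≃ₐ[F] L) * Module.finrank F L := by simp [Module.finrank_pi_fintype]
    _ = _ := by rw [← IsGalois.card_aut_eq_finrank, Nat.card_eq_fintype_card]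

open Classical in
theorem coeff_ofField (hξ : IsMulCocycle₂ ξ) (a : L) (σ : L ≃ₐ[F] L) :
    coeff hξ (ofField hξ a) σ = if σ = 1 then a * ((ξ (1, 1))⁻¹ : Lˣ) else 0 :=
  coeff_single 1 σ _

/-- The matrix of left multiplication by `b` on the crossed product, viewed as a right vector space
over `L` with basis `(u_σ)`. -/
def leftMulMatrix (hξ : IsMulCocycle₂ ξ) :
    CrossedProduct hξ →ₗ[F] Matrix (L ≃ₐ[F] L) (L ≃ₐ[F] L) L where
  toFun b := .of fun σ ρ => σ⁻¹ (coeff hξ b (σ * ρ⁻¹) * ξ (σ * ρ⁻¹, ρ))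
  map_add' a b := by
    ext σ ρ
    simp [add_mul]
  map_smul' c b := by
    ext σ ρ
    simp

theorem leftMulMatrix_apply (hξ : IsMulCocycle₂ ξ) (b : CrossedProduct hξ) (σ ρ : L ≃ₐ[F] L) :
    leftMulMatrix hξ b σ ρ = σ⁻¹ (coeff hξ b (σ * ρ⁻¹) * ξ (σ * ρ⁻¹, ρ)) := rfl

theorem leftMulMatrix_mul (hξ : IsMulCocycle₂ ξ) (a b : CrossedProduct hξ) :
    leftMulMatrix hξ (a * b) = leftMulMatrix hξ a * leftMulMatrix hξ b := by
  ext σ ρ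
  simp only [leftMulMatrix_apply, Matrix.mul_apply, coeff_mul, Finset.sum_mul, map_sum]
  refine Fintype.sum_equiv ((Equiv.inv _).trans (Equiv.mulRight σ)) _ _ fun π => ?_
  have hcocycle := cocycle hξ π (π⁻¹ * (σ * ρ⁻¹)) ρ
  have hσ : σ * (π⁻¹ * σ)⁻¹ = π := by group
  have hρ : π⁻¹ * σ * ρ⁻¹ = π⁻¹ * (σ * ρ⁻¹) := by group
  have hσρ : π * (π⁻¹ * (σ * ρ⁻¹)) = σ * ρ⁻¹ := by group
  have hπσ : π⁻¹ * (σ * ρ⁻¹) * ρ = π⁻¹ * σ := by group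
  have hinv (y : L) : (π⁻¹ * σ)⁻¹ y = σ⁻¹ (π y) := by
    rw [mul_inv_rev, inv_inv, AlgEquiv.mul_apply]
  rw [hσρ, hπσ] at hcocycle
  simp only [Equiv.trans_apply, Equiv.inv_apply, Equiv.coe_mulRight, hσ, hρ, hinv]
  rw [← map_mul, map_mul π]
  congr 1
  linear_combination (coeff hξ a π * π (coeff hξ b (π⁻¹ * (σ * ρ⁻¹)))) * hcocycle

section

variable [DecidableEq (L ≃ₐ[F] L)]

theorem leftMulMatrix_ofField (hξ : IsMulCocycle₂ ξ) (a : L) :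
    leftMulMatrix hξ (ofField hξ a) = .diagonal fun σ => σ⁻¹ a := by
  ext σ ρ
  rw [leftMulMatrix_apply, coeff_ofField, Matrix.diagonal_apply]
  simp only [mul_inv_eq_one]
  split_ifs with h
  · rw [h, mul_inv_cancel, map_one_fst_of_isMulCocycle₂ hξ ρ, mul_assoc, Units.inv_mul, mul_one]
  · simp

/-- The matrix representation of the crossed product over `L` given by left multiplication. -/
noncomputable def leftMulMatrixHom (hξ : IsMulCocycle₂ ξ) :
    CrossedProduct hξ →ₐ[F] Matrix (L ≃ₐ[F] L) (L ≃ₐ[F] L) L :=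
  .ofLinearMap (leftMulMatrix hξ)
    (by rw [← map_one (ofField hξ), leftMulMatrix_ofField]; simp)
    (leftMulMatrix_mul hξ)

variable {Ω : Type*} [Field Ω] [Algebra F Ω]

/-- The splitting of the crossed product over an extension `Ω` of `F` into which `L` embeds. -/
noncomputable def splittingHom (hξ : IsMulCocycle₂ ξ) (j : L →ₐ[F] Ω) :
    Ω ⊗[F] CrossedProduct hξ →ₐ[Ω] Matrix (L ≃ₐ[F] L) (L ≃ₐ[F] L) Ω :=
  AlgHom.liftEquiv F Ω _ _ (j.mapMatrix.comp (leftMulMatrixHom hξ))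

theorem splittingHom_one_tmul (hξ : IsMulCocycle₂ ξ) (j : L →ₐ[F] Ω) (b : CrossedProduct hξ) :
    splittingHom hξ j (1 ⊗ₜ b) = (leftMulMatrix hξ b).map j := by
  simp [splittingHom, leftMulMatrixHom]

theorem diagonal_mem_range_splittingHom (hξ : IsMulCocycle₂ ξ) (j : L →ₐ[F] Ω)
    (d : (L ≃ₐ[F] L) → Ω) : Matrix.diagonal d ∈ (splittingHom hξ j).range := by
  let T := Matrix.diagonalLinearMap (L ≃ₐ[F] L) Ω Ω ∘ₗ LinearMap.funLeft Ω Ω (·⁻¹)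
  have hspan : (splittingHom hξ j).range.toSubmodule.comap T = ⊤ := by
    rw [eq_top_iff, ← span_range_conjugates_eq_top (j : L →+* Ω), Submodule.span_le]
    rintro _ ⟨a, rfl⟩
    refine ⟨1 ⊗ₜ ofField hξ a, ?_⟩
    change splittingHom hξ j (1 ⊗ₜ ofField hξ a) = Matrix.diagonal fun σ => j (σ⁻¹ a)
    rw [splittingHom_one_tmul, leftMulMatrix_ofField, Matrix.diagonal_map (map_zero j)]
  have hd : d ∘ (·⁻¹) ∈ (splittingHom hξ j).range.toSubmodule.comap T := hspan ▸ Submodule.mem_top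
  simpa [T, LinearMap.funLeft, Function.comp_def] using hd

theorem single_mem_range_splittingHom (hξ : IsMulCocycle₂ ξ) (j : L →ₐ[F] Ω)
    (σ ρ : L ≃ₐ[F] L) (c : Ω) : Matrix.single σ ρ c ∈ (splittingHom hξ j).range := by
  have hdiag (π : L ≃ₐ[F] L) (c : Ω) : Matrix.single π π c ∈ (splittingHom hξ j).range := by
    rw [← Matrix.diagonal_single]
    exact diagonal_mem_range_splittingHom hξ j _
  let e : Ω := j (σ⁻¹ (ξ (σ * ρ⁻¹, ρ)))
  have he : e ≠ 0 := by simp [e]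
  have hu : (leftMulMatrix hξ (single hξ (σ * ρ⁻¹) 1)).map j ∈ (splittingHom hξ j).range :=
    ⟨_, splittingHom_one_tmul hξ j _⟩
  have hmul := mul_mem (mul_mem (hdiag σ (c * e⁻¹)) hu) (hdiag ρ 1)
  have hentry : (leftMulMatrix hξ (single hξ (σ * ρ⁻¹) 1)).map j σ ρ = e := by
    simp [leftMulMatrix_apply, coeff_single, e]
  rwa [Matrix.single_mul_mul_single, hentry, mul_one, inv_mul_cancel_right₀ he] at hmul

theorem splittingHom_surjective (hξ : IsMulCocycle₂ ξ) (j : L →ₐ[F] Ω) :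
    Function.Surjective (splittingHom hξ j) := by
  intro M
  rw [← AlgHom.mem_range, Matrix.matrix_eq_sum_single M]
  exact sum_mem fun σ _ => sum_mem fun ρ _ => single_mem_range_splittingHom hξ j σ ρ _

theorem splittingHom_bijective [IsGalois F L] (hξ : IsMulCocycle₂ ξ) (j : L →ₐ[F] Ω) :
    Function.Bijective (splittingHom hξ j) := by
  have hfinrank : Module.finrank Ω (Ω ⊗[F] CrossedProduct hξ) =
      Module.finrank Ω (Matrix (L ≃ₐ[F] L) (L ≃ₐ[F] L) Ω) := by
    rw [Module.finrank_baseChange, finrank_eq_card_mul_card, Module.finrank_matrix,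
      Module.finrank_self, mul_one]
  have hsurj := splittingHom_surjective hξ j
  exact ⟨(LinearMap.injective_iff_surjective_of_finrank_eq_finrank
    (f := (splittingHom hξ j).toLinearMap) hfinrank).2 hsurj, hsurj⟩

end

variable (F L) in
/-- The linear form `∑ σ, x_σ u_σ ↦ Tr_{L/F} (x_1 ξ(1, 1))`; the factor `ξ(1, 1)` is there because
`1 = ξ(1, 1)⁻¹ u_1`. -/
noncomputable def traceForm (hξ : IsMulCocycle₂ ξ) : CrossedProduct hξ →ₗ[F] F :=
  Algebra.trace F L ∘ₗ
    { toFun := fun b => coeff hξ b 1 * ξ (1, 1)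
      map_add' := fun a b => by simp [add_mul]
      map_smul' := fun c a => by simp }

theorem traceForm_apply (hξ : IsMulCocycle₂ ξ) (b : CrossedProduct hξ) :
    traceForm F L hξ b = Algebra.trace F L (coeff hξ b 1 * ξ (1, 1)) := rfl

theorem trace_leftMulMatrix [IsGalois F L] (hξ : IsMulCocycle₂ ξ) (b : CrossedProduct hξ) :
    (leftMulMatrix hξ b).trace = algebraMap F L (traceForm F L hξ b) := by
  rw [traceForm_apply, trace_eq_sum_automorphisms, Matrix.trace]
  refine Fintype.sum_equiv (Equiv.inv _) _ _ fun σ => ?_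
  rw [Matrix.diag_apply, leftMulMatrix_apply, mul_inv_cancel, map_one_fst_of_isMulCocycle₂ hξ σ,
    Equiv.inv_apply]

theorem isReducedTrace_traceForm [IsGalois F L] (hξ : IsMulCocycle₂ ξ) :
    IsReducedTrace F (CrossedProduct hξ) (traceForm F L hξ) := by
  classical
  let j : L →ₐ[F] AlgebraicClosure F := IsAlgClosed.lift
  let e := Fintype.equivFin (L ≃ₐ[F] L)
  refine ⟨_, (AlgEquiv.ofBijective _ (splittingHom_bijective hξ j)).trans
    (Matrix.reindexAlgEquiv _ _ e), fun b => ?_⟩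
  calc algebraMap F (AlgebraicClosure F) (traceForm F L hξ b)
      = j (leftMulMatrix hξ b).trace := by rw [trace_leftMulMatrix, j.commutes]
    _ = ((leftMulMatrix hξ b).map j).trace := AddMonoidHom.map_trace j _
    _ = (Matrix.reindex e e ((leftMulMatrix hξ b).map j)).trace :=
        (Equiv.sum_comp e.symm fun σ => j (leftMulMatrix hξ b σ σ)).symm
    _ = _ := by simp [splittingHom_one_tmul]

theorem reducedTrace_ofField [IsGalois F L] (hξ : IsMulCocycle₂ ξ) (a : L) :
    reducedTrace F (CrossedProduct hξ) (ofField hξ a) = Algebra.trace F L a := by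
  rw [(isReducedTrace_traceForm hξ).reducedTrace_eq, traceForm_apply, coeff_ofField, if_pos rfl,
    mul_assoc, Units.inv_mul, mul_one]

end CrossedProduct

theorem proposition3p1_general {F L : Type*} [Field F] [Field L] [Algebra F L]
    [FiniteDimensional F L] [IsGalois F L] (ι : L →+* ℂ)
    (α : L →+* L) (hα : ∀ x : L, ι (α x) = starRingEnd ℂ (ι x))
    (ξ : (L ≃ₐ[F] L) × (L ≃ₐ[F] L) → Lˣ) (hξ : IsMulCocycle₂ ξ)
    (τ : CrossedProduct hξ → CrossedProduct hξ)
    (hpos : IsPositiveInvolution (ι.comp (algebraMap F L)) τ)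
    (hτα : ∀ x : L, τ (CrossedProduct.ofField hξ x) = CrossedProduct.ofField hξ (α x))
    (σ : L ≃ₐ[F] L) (x : L) : α (σ x) = σ (α x) := by
  refine map_comm_of_trace_mul_self_nonneg ι α hα (fun y => ?_) σ x
  rcases eq_or_ne y 0 with rfl | hy
  · simp
  · have htrace := hpos (CrossedProduct.ofField hξ y) ((map_ne_zero _).2 hy)
    rw [hτα, ← map_mul, CrossedProduct.reducedTrace_ofField] at htrace
    exact htrace.le

theorem proposition3p1
    {k₀ k L : Type*} [Field k₀] [NumberField k₀] [Field k] [NumberField k] [Field L]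
    [Algebra k₀ k] (hk : Module.finrank k₀ k = 2)
    [Algebra k L] [FiniteDimensional k L] [IsGalois k L]
    -- `L` (and with it `k` and `k₀`) is a subfield of `ℂ`
    (ι : L →+* ℂ)
    -- the nontrivial automorphism `c` of `k / k₀` is complex conjugation
    (c : k ≃ₐ[k₀] k) (hc_ne : c ≠ 1)
    (hc : ∀ a : k, ι (algebraMap k L (c a)) = starRingEnd ℂ (ι (algebraMap k L a)))
    -- complex conjugation induces the automorphism `α` of `L`
    (α : L ≃+* L) (hα : ∀ x : L, ι (α x) = starRingEnd ℂ (ι x))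
    (ξ : (L ≃ₐ[k] L) × (L ≃ₐ[k] L) → Lˣ) (hξ : groupCohomology.IsMulCocycle₂ ξ)
    (hξα : ∀ σ ρ : L ≃ₐ[k] L, α (ξ (σ, ρ) : L) * (ξ (σ, ρ) : L) = 1)
    -- the crossed product `B = (ξ, L/k, Gal(L/k))` is a division algebra
    (hdiv : ∀ b : CrossedProduct hξ, b ≠ 0 → IsUnit b)
    -- `τ` is a positive unitary `k / k₀`-involution on `B` that restricts to `α` on `L`
    (τ : CrossedProduct hξ → CrossedProduct hξ)
    (hτ : IsUnitaryInvolution c τ)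
    (hpos : IsPositiveInvolution (ι.comp (algebraMap k L)) τ)
    (hτα : ∀ x : L, τ (CrossedProduct.ofField hξ x) = CrossedProduct.ofField hξ (α x)) :
    ∀ (σ : L ≃ₐ[k] L) (x : L), α (σ x) = σ (α x) :=
  proposition3p1_general ι α hα ξ hξ τ hpos hτα
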